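/- Let $\tau=\frac{1+\sqrt5}{2}$, $\tau'=\frac{1-\sqrt5}{2}$, and let $\mathbf{Fib}=\{m+n\tau : m,n\in\mathbb{Z},\ m+n\tau'\in[-1,\tau-1)\}$ be the Fibonacci model set. Let $\mathcal{A}=(A_n)$ be a van Hove sequence in $\mathbb{R}$, that is, a sequence of compact sets with Lebesgue measure $|A_n|>0$ such that $|\partial^K A_n|/|A_n|\to0$ for every nonempty compact $K\subset\mathbb{R}$, where $\partial^K B=((K+B)\setminus B^\circ)\cup((-K+\overline{\mathbb{R}\setminus B})\cap B)$. Let $\Lambda\subseteq\mathbf{Fib}$ be such that the limits $$\eta(z)=\lim_{n\to\infty}\frac{1}{|A_n|}\,\#\{(x,y) : x,y\in\Lambda\cap A_n,\ x-y=z\}$$ exist for all $z\in\Lambda-\Lambda$, and let $\gamma=\sum_{z\in\Lambda-\Lambda}\eta(z)\delta_z$ be the autocorrelation of $\Lambda$ with respect to $\mathcal{A}$. Let $\widehat{\gamma}$ be the diffraction measure of $\Lambda$, i.e. the Fourier transform of $\gamma$: the positive Radon measure on $\mathbb{R}$ such that for every continuous compactly supported $\varphi:\mathbb{R}\to\mathbb{C}$,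 with $\check\varphi(k)=\int_{\mathbb{R}} e^{2\pi i kx}\varphi(x)\,dx$ and $\tilde\varphi(x)=\overline{\varphi(-x)}$, one has $\check\varphi\in L^2(\widehat{\gamma})$ and $\int\varphi*\tilde\varphi\,d\gamma=\int|\check\varphi|^2\,d\widehat{\gamma}$. We say that $\Lambda$ has a Bragg peak at $k\in\mathbb{R}$ of intensity $\widehat{\gamma}(\{k\})$ if $\widehat{\gamma}(\{k\})>0$. Assume that $I:=\widehat{\gamma}(\{0\})>0$. Then: 1. For every $0<\varepsilon<1$ and every $x\in\mathbb{R}$, $\Lambda$ has a Bragg peak in the interval $\left[x,\,x+\frac{2\pi\tau^4}{5\varepsilon}\right]$ of intensity at least $(1-\varepsilon)I$. 2. For every $x\in\mathbb{R}$, $\Lambda$ has a Bragg peak in the interval $\left[x,\,x+\frac{2\pi\tau^4}{5}\right]$. -/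

import Mathlib

open Real MeasureTheory Filter Topology
open scoped Pointwise FourierTransform ComplexConjugate

noncomputable section

/-- For a window `W ⊆ ℝ`, the set of all `x = m + n τ` (`m, n ∈ ℤ`) whose Galois conjugate
`x⋆ = m + n τ'` lies in `W`. Here `τ = goldenRatio = (1 + √5) / 2` and
`τ' = goldenConj = (1 - √5) / 2`; the pair `(m, n)` is determined by `x`, as `τ` is irrational. -/
def goldenModelSet (W : Set ℝ) : Set ℝ :=
  {x | ∃ m n : ℤ, x = m + n * goldenRatio ∧ (m + n * goldenConj : ℝ) ∈ W}

/-- The Fibonacci model set, with window `[-1, τ - 1)`. -/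
def Fib : Set ℝ := goldenModelSet (Set.Ico (-1) (goldenRatio - 1))

/-- The `K`-boundary of `B`. -/
def kBoundary (K B : Set ℝ) : Set ℝ :=
  ((K + B) \ interior B) ∪ ((-K + closure Bᶜ) ∩ B)

/-- Van Hove sequences in `ℝ`: compact sets of positive Lebesgue measure whose `K`-boundaries are
asymptotically negligible, for every nonempty compact `K`. -/
structure IsVanHove (A : ℕ → Set ℝ) : Prop where
  isCompact : ∀ n, IsCompact (A n)
  volume_pos : ∀ n, 0 < volume (A n)
  tendsto_kBoundary : ∀ K : Set ℝ, IsCompact K → K.Nonempty →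
    Tendsto (fun n => volume.real (kBoundary K (A n)) / volume.real (A n)) atTop (𝓝 0)

/-- `γ` is the autocorrelation of (the Dirac comb of) `Λ` with respect to `A`: the limits
`η(z) = lim_n |A_n|⁻¹ · #{(x, y) : x, y ∈ Λ ∩ A_n, x - y = z}` exist for all `z ∈ Λ - Λ`, and
`γ = ∑_{z ∈ Λ - Λ} η(z) δ_z`. -/
def IsAutocorrelation (Λ : Set ℝ) (A : ℕ → Set ℝ) (γ : Measure ℝ) : Prop :=
  ∃ η : ℝ → ℝ,
    (∀ z ∈ Λ - Λ, Tendsto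
      (fun n => (Set.ncard {p : ℝ × ℝ | p.1 ∈ Λ ∩ A n ∧ p.2 ∈ Λ ∩ A n ∧ p.1 - p.2 = z} : ℝ)
        / volume.real (A n)) atTop (𝓝 (η z))) ∧
    γ = Measure.sum (fun z : ↥(Λ - Λ) => ENNReal.ofReal (η z) • Measure.dirac (z : ℝ))

/-- The positive Radon measure `ν` is the Fourier transform of the measure `μ`: for every
continuous compactly supported `φ`, the inverse Fourier transform `φˇ(k) = ∫ e^{2πikx} φ(x) dx` is
in `L²(ν)` and `μ(φ * φ~) = ν(|φˇ|²)`, where `φ~(x) = conj (φ (-x))`. The dual group of `ℝ` is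
identified with `ℝ`, the point `k` being the character `x ↦ e^{2πikx}`. -/
def IsFourierTransform (μ ν : Measure ℝ) : Prop :=
  IsLocallyFiniteMeasure ν ∧
    ∀ φ : ℝ → ℂ, Continuous φ → HasCompactSupport φ →
      MemLp (𝓕⁻ φ) 2 ν ∧
      ∫ x, (convolution φ (fun y => conj (φ (-y))) (ContinuousLinearMap.mul ℂ ℂ) volume) x ∂μ
        = ((∫ k, ‖𝓕⁻ φ k‖ ^ 2 ∂ν : ℝ) : ℂ)

/-- `ν` is the diffraction measure of `Λ` with respect to `A`: the autocorrelation of `Λ` exists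
with respect to `A`, and `ν` is its Fourier transform. -/
def IsDiffractionMeasure (Λ : Set ℝ) (A : ℕ → Set ℝ) (ν : Measure ℝ) : Prop :=
  ∃ γ : Measure ℝ, IsAutocorrelation Λ A γ ∧ IsFourierTransform γ ν

/-- The intensity `ν({k})` of a diffraction measure `ν` at `k`. -/
def braggIntensity (ν : Measure ℝ) (k : ℝ) : ℝ := ν.real {k}

/-- A diffraction measure has a Bragg peak at `k` if `k` is an atom. -/
def HasBraggPeak (ν : Measure ℝ) (k : ℝ) : Prop := 0 < braggIntensity ν k

end

/-! Write z⋆ for the Galois conjugate of z in ℤ[τ]. If (k, l) is in the dual lattice, then kz + lz⋆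
is an integer, so e^{2πikz} = e^{-2πilz⋆}. For z in `Fib - Fib`, |z⋆| ≤ τ, hence a small l makes k
an almost period: cos(2πkz) ≥ 1 - ε (`IsGoldenDual.one_sub_le_cos`). Such k are relatively dense
(`exists_isGoldenDual_mem_Icc`).

An atom of ν is a limit of integrals of cos(2πkx) against nonnegative correlations over γ, with test
functions independent of k (`tendsto_integral_norm_sq_fourierInv`,
`IsFourierTransform.integral_norm_sq_modulate`). As γ lives on `Λ - Λ`, the bound on the cosine
passes to ν({k}) ≥ (1 - ε) ν({0}). -/

/-! ### The dual lattice and its points with small conjugate -/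

/-- The pair `(k, l)` lies in the dual lattice of `{(m + n τ, m + n τ') : m, n ∈ ℤ}`. -/
def IsGoldenDual (k l : ℝ) : Prop :=
  ∀ m n : ℤ, ∃ j : ℤ, k * (m + n * goldenRatio) + l * (m + n * goldenConj) = j

lemma isGoldenDual_sqrt_five_inv : IsGoldenDual (1 / √5) (-(1 / √5)) := by
  intro m n
  refine ⟨n, ?_⟩
  have h5 : √5 ≠ 0 := by positivity
  have := goldenRatio_sub_goldenConj
  field_simp
  linear_combination (n : ℝ) * this

/-- The unit τ can be moved onto the lattice point: (τk)x + (τ'l)x⋆ = k(τx) + l(τx)⋆, with τ(m + nτ)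
= n + (m + n)τ. -/
lemma IsGoldenDual.golden_mul {k l : ℝ} (h : IsGoldenDual k l) :
    IsGoldenDual (goldenRatio * k) (goldenConj * l) := by
  intro m n
  obtain ⟨j, hj⟩ := h n (m + n)
  refine ⟨j, ?_⟩
  rw [← hj]
  push_cast
  linear_combination k * n * goldenRatio_sq + l * n * goldenConj_sq

lemma IsGoldenDual.golden_pow_mul {k l : ℝ} (h : IsGoldenDual k l) (N : ℕ) :
    IsGoldenDual (goldenRatio ^ N * k) (goldenConj ^ N * l) := by
  induction N with
  | zero => simpa using h
  | succ N ih => simpa [pow_succ', mul_assoc] using ih.golden_mul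

lemma IsGoldenDual.add {k l k' l' : ℝ} (h : IsGoldenDual k l) (h' : IsGoldenDual k' l') :
    IsGoldenDual (k + k') (l + l') := by
  intro m n
  obtain ⟨j, hj⟩ := h m n
  obtain ⟨j', hj'⟩ := h' m n
  refine ⟨j + j', ?_⟩
  push_cast
  rw [← hj, ← hj']
  ring

lemma IsGoldenDual.int_mul {k l : ℝ} (h : IsGoldenDual k l) (a : ℤ) :
    IsGoldenDual (a * k) (a * l) := by
  intro m n
  obtain ⟨j, hj⟩ := h m n
  refine ⟨a * j, ?_⟩
  push_cast
  rw [← hj]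
  ring

/-- Every translate of a suitable box contains a point of the Minkowski embedding of `ℤ[τ]`. -/
lemma exists_int_add_golden_mem_box (y : ℝ) :
    ∃ a b : ℤ, a + b * goldenRatio ∈ Set.Icc y (y + goldenRatio ^ 2) ∧
      |a + b * goldenConj| ≤ goldenRatio / 2 := by
  have h5 : 0 < √5 := by positivity
  have hs := goldenRatio_sub_goldenConj
  have hadd := goldenRatio_add_goldenConj
  have hpos := goldenRatio_pos
  have hneg := goldenConj_neg
  -- Rounding up both coordinates moves the conjugate by an amount in [τ', 1], of length τ; this q
  -- centres the result on [-τ/2, τ/2].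
  set q : ℝ := (goldenRatio - 2) / 2 with hq
  obtain ⟨u, v, hu, hv⟩ : ∃ u v : ℝ, u + v * goldenRatio = y ∧ u + v * goldenConj = q := by
    refine ⟨y - (y - q) / √5 * goldenRatio, (y - q) / √5, by ring, ?_⟩
    have : (y - q) / √5 * √5 = y - q := by field_simp
    linear_combination -this + (y - q) / √5 * (-hs)
  refine ⟨⌈u⌉, ⌈v⌉, ?_, ?_⟩
  · have h1 := Int.le_ceil u
    have h2 := (Int.ceil_lt_add_one u).le
    have h3 := mul_le_mul_of_nonneg_right (Int.le_ceil v) hpos.le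
    have h4 := mul_le_mul_of_nonneg_right (Int.ceil_lt_add_one v).le hpos.le
    rw [goldenRatio_sq]
    constructor <;> linarith
  · have h1 := Int.le_ceil u
    have h2 := (Int.ceil_lt_add_one u).le
    have h3 := mul_le_mul_of_nonpos_right (Int.le_ceil v) hneg.le
    have h4 := mul_le_mul_of_nonpos_right (Int.ceil_lt_add_one v).le hneg.le
    rw [abs_le]
    constructor <;> linarith

/-- The points `k` of the dual lattice whose conjugate is small are relatively dense. -/
lemma exists_isGoldenDual_mem_Icc {ε : ℝ} (hε : 0 < ε) (hε1 : ε ≤ 1) (x : ℝ) :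
    ∃ k l : ℝ, IsGoldenDual k l ∧ k ∈ Set.Icc x (x + π * goldenRatio ^ 5 / (5 * ε)) ∧
      |l| ≤ ε / (2 * π * goldenRatio) := by
  have h5 : 0 < √5 := by positivity
  have hsq : √5 * √5 = 5 := Real.mul_self_sqrt (by norm_num)
  have hg := one_lt_goldenRatio
  have hpos := goldenRatio_pos
  have hX : 1 ≤ π * goldenRatio ^ 2 / (√5 * ε) := by
    rw [one_le_div (by positivity)]
    have h3 : √5 ≤ 3 := by rw [Real.sqrt_le_left (by norm_num)]; norm_num
    have : 1 ≤ goldenRatio ^ 2 := one_le_pow₀ hg.le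
    nlinarith [Real.pi_gt_three]
  -- With X = πτ²/(√5 ε), τ^N lies in (X, τX]: the lower bound makes the conjugate small enough, the
  -- upper one bounds the gap.
  obtain ⟨M, hM1, hM2⟩ := exists_nat_pow_near hX hg
  set N := M + 1
  set r : ℝ := goldenRatio ^ N * (1 / √5) with hr
  set s : ℝ := goldenConj ^ N * (-(1 / √5)) with hs
  have hrpos : 0 < r := by positivity
  have hd : IsGoldenDual r s := isGoldenDual_sqrt_five_inv.golden_pow_mul N
  obtain ⟨a, b, hab, hab'⟩ := exists_int_add_golden_mem_box (x / r)
  refine ⟨a * r + b * (goldenRatio * r), a * s + b * (goldenConj * s),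
    (hd.int_mul a).add (hd.golden_mul.int_mul b), ?_, ?_⟩
  · have hle : r * goldenRatio ^ 2 ≤ π * goldenRatio ^ 5 / (5 * ε) := by
      have : goldenRatio ^ N ≤ goldenRatio * (π * goldenRatio ^ 2 / (√5 * ε)) := by
        rw [pow_succ']; gcongr
      calc r * goldenRatio ^ 2
          ≤ goldenRatio * (π * goldenRatio ^ 2 / (√5 * ε)) * (1 / √5) * goldenRatio ^ 2 := by
            rw [hr]; gcongr
        _ = π * goldenRatio ^ 5 / ((√5 * √5) * ε) := by field_simp
        _ = _ := by rw [hsq]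
    have h1 : x = x / r * r := by field_simp
    have h2 := mul_le_mul_of_nonneg_right hab.1 hrpos.le
    have h3 := mul_le_mul_of_nonneg_right hab.2 hrpos.le
    constructor <;> linarith
  · have hconj : |goldenConj| = goldenRatio⁻¹ := by
      rw [abs_of_neg goldenConj_neg, inv_goldenRatio]
    have hsabs : |s| = (goldenRatio ^ N)⁻¹ * (1 / √5) := by
      rw [hs, abs_mul, abs_pow, hconj, abs_neg, abs_of_pos (by positivity : 0 < 1 / √5), inv_pow]
    calc |a * s + b * (goldenConj * s)| = |a + b * goldenConj| * |s| := by
          rw [← abs_mul]; congr 1; ring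
      _ ≤ goldenRatio / 2 * ((π * goldenRatio ^ 2 / (√5 * ε))⁻¹ * (1 / √5)) := by
          rw [hsabs]; gcongr
      _ = ε / (2 * π * goldenRatio) := by field_simp

/-! ### The difference set of `Fib` -/

/-- For z = m + nτ both z and z⋆ are bounded, and z - z⋆ = n√5 bounds n, hence m. -/
lemma finite_golden_sub_inter_Icc (a : ℝ) : (((Fib - Fib) ∩ Set.Icc (-a) a).Finite) := by
  have hs := goldenRatio_sub_goldenConj
  have h5 : 2 ≤ √5 := by exact Real.le_sqrt_of_sq_le (by norm_num)
  have hg := goldenRatio_lt_two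
  have hpos := goldenRatio_pos
  set B : ℤ := ⌈3 * a + 6⌉
  refine Set.Finite.subset (((Set.finite_Icc (-B) B).prod (Set.finite_Icc (-B) B)).image
    (fun p : ℤ × ℤ => (p.1 + p.2 * goldenRatio : ℝ))) ?_
  rintro _ ⟨⟨_, ⟨m, n, rfl, h1, h1'⟩, _, ⟨m', n', rfl, h2, h2'⟩, rfl⟩, h3, h4⟩
  refine ⟨(m - m', n - n'), ?_, by push_cast; ring⟩
  have hn : |(n - n' : ℝ)| * 2 ≤ a + 2 := by
    calc |(n - n' : ℝ)| * 2 ≤ |(n - n' : ℝ)| * |√5| := by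
          gcongr; rwa [abs_of_pos (by linarith)]
      _ = |(n - n' : ℝ) * √5| := (abs_mul _ _).symm
      _ ≤ a + 2 := by
        rw [← hs, abs_le]
        constructor <;> nlinarith
  have hm : |(m - m' : ℝ)| ≤ 3 * a + 6 := by
    have h6 : |(n - n' : ℝ) * goldenRatio| ≤ a + 2 := by
      rw [abs_mul, abs_of_pos hpos]
      exact (mul_le_mul_of_nonneg_left hg.le (abs_nonneg _)).trans hn
    rw [abs_le] at h6 ⊢
    obtain ⟨h6, h6'⟩ := h6
    constructor <;> nlinarith
  have hB : 3 * a + 6 ≤ B := Int.le_ceil _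
  have ha : 0 ≤ |(n - n' : ℝ)| := abs_nonneg _
  have hn' : |(n - n' : ℝ)| ≤ 3 * a + 6 := by linarith
  rw [abs_le] at hm hn'
  simp only [Set.mem_prod, Set.mem_Icc]
  refine ⟨⟨?_, ?_⟩, ⟨?_, ?_⟩⟩ <;> · rify; linarith

/-- Dual lattice points with small conjugate are almost periods of `Fib - Fib`. -/
lemma IsGoldenDual.one_sub_le_cos {k l ε : ℝ} (h : IsGoldenDual k l) (hε : 0 < ε) (hε1 : ε ≤ 1)
    (hl : |l| ≤ ε / (2 * π * goldenRatio)) {z : ℝ} (hz : z ∈ Fib - Fib) :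
    1 - ε ≤ Real.cos (2 * π * k * z) := by
  have hpos := goldenRatio_pos
  obtain ⟨_, ⟨m, n, rfl, h1, h1'⟩, _, ⟨m', n', rfl, h2, h2'⟩, rfl⟩ := hz
  obtain ⟨j, hj⟩ := h (m - m') (n - n')
  push_cast at hj
  set w : ℝ := (m - m') + (n - n') * goldenConj with hw
  have hwabs : |w| ≤ goldenRatio := by
    rw [abs_le]; constructor <;> linarith
  have hcos : Real.cos (2 * π * k * ((m + n * goldenRatio) - (m' + n' * goldenRatio)))
      = Real.cos (2 * π * l * w) := by
    rw [← Real.cos_int_mul_two_pi_sub _ j, ← hj]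
    congr 1; ring
  have hle : |2 * π * l * w| ≤ ε := by
    calc |2 * π * l * w| = 2 * π * |l| * |w| := by
          rw [abs_mul, abs_mul, abs_of_pos (by positivity : 0 < 2 * π)]
      _ ≤ 2 * π * (ε / (2 * π * goldenRatio)) * goldenRatio := by gcongr
      _ = ε := by field_simp
  have hsq : (2 * π * l * w) ^ 2 ≤ ε ^ 2 := sq_le_sq' (by linarith [neg_le_of_abs_le hle])
    (le_of_abs_le hle)
  rw [hcos]
  -- The cosine is at least 1 - ε²/2, which is at least 1 - ε.
  have := Real.one_sub_sq_div_two_le_cos (x := 2 * π * l * w)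
  nlinarith

/-! ### The autocorrelation measure -/

lemma IsAutocorrelation.isLocallyFiniteMeasure {Λ : Set ℝ} {A : ℕ → Set ℝ} {γ : Measure ℝ}
    (h : IsAutocorrelation Λ A γ) (hfin : ∀ a, ((Λ - Λ) ∩ Set.Icc (-a) a).Finite) :
    IsLocallyFiniteMeasure γ := by
  obtain ⟨η, -, rfl⟩ := h
  refine ⟨fun x => ⟨Set.Icc (-(|x| + 1)) (|x| + 1), Icc_mem_nhds ?_ ?_, ?_⟩⟩
  · linarith [neg_abs_le x]
  · linarith [le_abs_self x]
  · rw [Measure.sum_apply _ measurableSet_Icc]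
    have hf : {z : ↥(Λ - Λ) | (z : ℝ) ∈ Set.Icc (-(|x| + 1)) (|x| + 1)}.Finite :=
      Set.Finite.of_finite_image ((hfin (|x| + 1)).subset (by
        rintro _ ⟨z, hz, rfl⟩; exact ⟨z.2, hz⟩)) Subtype.val_injective.injOn
    rw [tsum_eq_sum (s := hf.toFinset)]
    · refine ENNReal.sum_lt_top.2 fun z _ => ?_
      simp only [Measure.smul_apply, smul_eq_mul]
      exact ENNReal.mul_lt_top ENNReal.ofReal_lt_top (measure_lt_top _ _)
    · intro z hz
      have : (z : ℝ) ∉ Set.Icc (-(|x| + 1)) (|x| + 1) := by simpa using hz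
      rw [Measure.smul_apply, Measure.dirac_apply' _ measurableSet_Icc,
        Set.indicator_of_notMem this, smul_zero]

lemma IsAutocorrelation.ae_mem {Λ : Set ℝ} {A : ℕ → Set ℝ} {γ : Measure ℝ}
    (h : IsAutocorrelation Λ A γ) {p : ℝ → Prop} (hp : MeasurableSet {z | p z})
    (hΛ : ∀ z ∈ Λ - Λ, p z) : ∀ᵐ z ∂γ, p z := by
  obtain ⟨η, -, rfl⟩ := h
  change (Measure.sum _) {z | p z}ᶜ = 0
  rw [Measure.sum_apply _ hp.compl, ENNReal.tsum_eq_zero]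
  intro z
  have := hΛ z z.2
  simp [Measure.dirac_apply' _ hp.compl, this]

/-! ### Averaged test functions and their Fourier transforms -/

/-- The function `φ` multiplied by the character `x ↦ e^{-2πikx}`. -/
noncomputable def modulate (k : ℝ) (f : ℝ → ℝ) (x : ℝ) : ℂ :=
  Complex.exp (-(2 * π * k * x : ℝ) * Complex.I) * f x

/-- The mean of the translates of `f` by `0, a, …, (N - 1) a`. -/
noncomputable def translateMean (N : ℕ) (a : ℝ) (f : ℝ → ℝ) (x : ℝ) : ℝ :=
  (N : ℝ)⁻¹ * ∑ i ∈ Finset.range N, f (x + i * a)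

/-- The mean of `1, w, …, w ^ (N - 1)`. -/
noncomputable def powMean (N : ℕ) (w : ℂ) : ℂ := (N : ℂ)⁻¹ * ∑ i ∈ Finset.range N, w ^ i

lemma norm_powMean_le (N : ℕ) {w : ℂ} (hw : ‖w‖ = 1) : ‖powMean N w‖ ≤ 1 := by
  rw [powMean, norm_mul, norm_inv, Complex.norm_natCast]
  have : ‖∑ i ∈ Finset.range N, w ^ i‖ ≤ N := by
    refine (norm_sum_le _ _).trans ?_
    simp [hw]
  exact inv_mul_le_one_of_le₀ this (Nat.cast_nonneg N)

lemma powMean_one {N : ℕ} (hN : N ≠ 0) : powMean N 1 = 1 := by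
  simp [powMean, hN]

lemma tendsto_powMean {w : ℂ} (hw : ‖w‖ = 1) (h1 : w ≠ 1) :
    Tendsto (fun N => powMean N w) atTop (𝓝 0) := by
  have hpos : 0 < ‖w - 1‖ := norm_pos_iff.2 (sub_ne_zero.2 h1)
  refine squeeze_zero_norm (a := fun N : ℕ => (N : ℝ)⁻¹ * (2 / ‖w - 1‖)) (fun N => ?_) ?_
  · rw [powMean, norm_mul, norm_inv, Complex.norm_natCast, geom_sum_eq h1, norm_div]
    gcongr
    calc ‖w ^ N - 1‖ ≤ ‖w ^ N‖ + ‖(1 : ℂ)‖ := norm_sub_le _ _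
      _ = 2 := by rw [norm_pow, hw]; norm_num
  · simpa using (tendsto_inv_atTop_nhds_zero_nat (𝕜 := ℝ)).mul_const (2 / ‖w - 1‖)

lemma continuous_modulate (k : ℝ) {f : ℝ → ℝ} (hf : Continuous f) :
    Continuous (modulate k f) := by
  unfold modulate; fun_prop

lemma hasCompactSupport_modulate (k : ℝ) {f : ℝ → ℝ} (hf : HasCompactSupport f) :
    HasCompactSupport (modulate k f) := by
  refine hf.mono' ((Function.support_subset_iff'.2 fun x hx => ?_).trans (subset_tsupport f))
  simp [modulate, Function.notMem_support.1 hx]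

lemma continuous_translateMean (N : ℕ) (a : ℝ) {f : ℝ → ℝ} (hf : Continuous f) :
    Continuous (translateMean N a f) := by
  unfold translateMean; fun_prop

lemma hasCompactSupport_translateMean (N : ℕ) (a : ℝ) {f : ℝ → ℝ} (hf : HasCompactSupport f) :
    HasCompactSupport (translateMean N a f) := by
  unfold translateMean
  refine HasCompactSupport.mul_left ?_
  induction N with
  | zero =>
    simp only [Finset.range_zero, Finset.sum_empty]
    exact HasCompactSupport.zero
  | succ N ih =>
    simp only [Finset.sum_range_succ]
    exact ih.add (hf.comp_homeomorph (Homeomorph.addRight (N * a : ℝ)))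

lemma translateMean_nonneg (N : ℕ) (a : ℝ) {f : ℝ → ℝ} (hf : ∀ x, 0 ≤ f x) (x : ℝ) :
    0 ≤ translateMean N a f x :=
  mul_nonneg (by positivity) (Finset.sum_nonneg fun _ _ => hf _)

lemma fourierInv_modulate (k : ℝ) (f : ℝ → ℝ) (y : ℝ) :
    𝓕⁻ (modulate k f) y = ∫ v : ℝ, Complex.exp ((2 * π * (y - k) * v : ℝ) * Complex.I) * f v := by
  rw [Real.fourierInv_eq']
  refine integral_congr_ae (Eventually.of_forall fun v => ?_)
  simp only [modulate, smul_eq_mul, ← mul_assoc, ← Complex.exp_add]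
  congr 2
  simp
  ring

lemma fourierInv_modulate_self (k : ℝ) (f : ℝ → ℝ) :
    𝓕⁻ (modulate k f) k = ((∫ v, f v : ℝ) : ℂ) := by
  rw [fourierInv_modulate]
  simp [integral_complex_ofReal]

/-- Each translation by a becomes the phase e^{2πi(k-y)a}, so averaging translates averages powers
of that phase. -/
lemma fourierInv_modulate_translateMean (N : ℕ) (a k : ℝ) {f : ℝ → ℝ} (hf : Continuous f)
    (hc : HasCompactSupport f) (y : ℝ) :
    𝓕⁻ (modulate k (translateMean N a f)) y =
      powMean N (Complex.exp ((2 * π * (k - y) * a : ℝ) * Complex.I)) * 𝓕⁻ (modulate k f) y := by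
  simp only [fourierInv_modulate, translateMean, powMean]
  have hint : ∀ i : ℕ, Integrable (fun v : ℝ =>
      Complex.exp ((2 * π * (y - k) * v : ℝ) * Complex.I) * f (v + i * a)) := fun i => by
    refine Continuous.integrable_of_hasCompactSupport (by fun_prop) (HasCompactSupport.mul_left ?_)
    exact (hc.comp_homeomorph (Homeomorph.addRight (i * a : ℝ))).comp_left Complex.ofReal_zero
  have hshift : ∀ i : ℕ, ∫ v : ℝ,
      Complex.exp ((2 * π * (y - k) * v : ℝ) * Complex.I) * f (v + i * a) =
      Complex.exp ((2 * π * (k - y) * a : ℝ) * Complex.I) ^ i *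
        ∫ v : ℝ, Complex.exp ((2 * π * (y - k) * v : ℝ) * Complex.I) * f v := fun i => by
    rw [← integral_add_right_eq_self (fun v : ℝ =>
      Complex.exp ((2 * π * (y - k) * v : ℝ) * Complex.I) * f v) (i * a : ℝ), ← integral_const_mul]
    refine integral_congr_ae (Eventually.of_forall fun v => ?_)
    simp only [← Complex.exp_nat_mul, ← mul_assoc, ← Complex.exp_add]
    congr 2
    push_cast
    ring
  rw [mul_assoc (N : ℂ)⁻¹, Finset.sum_mul, ← Finset.sum_congr rfl fun i _ => hshift i,
    ← integral_finsetSum _ fun i _ => hint i, ← integral_const_mul]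
  refine integral_congr_ae (Eventually.of_forall fun v => ?_)
  simp only [Complex.ofReal_mul, Complex.ofReal_sum, Finset.mul_sum]
  refine Finset.sum_congr rfl fun i _ => ?_
  push_cast
  ring

/-- The autocorrelation `x ↦ ∫ f(t) f(t - x) dt` of a real function. -/
noncomputable def selfCorrelation (f : ℝ → ℝ) (x : ℝ) : ℝ := ∫ t, f t * f (t - x)

lemma selfCorrelation_nonneg {f : ℝ → ℝ} (hf : ∀ x, 0 ≤ f x) (x : ℝ) : 0 ≤ selfCorrelation f x :=
  integral_nonneg fun _ => mul_nonneg (hf _) (hf _)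

lemma integrable_selfCorrelation {f : ℝ → ℝ} (hf : Continuous f) (hc : HasCompactSupport f)
    (γ : Measure ℝ) [IsLocallyFiniteMeasure γ] : Integrable (selfCorrelation f) γ := by
  have heq : selfCorrelation f =
      convolution f (fun y => f (-y)) (ContinuousLinearMap.mul ℝ ℝ) volume := by
    ext x
    simp [selfCorrelation, convolution]
  have hc' : HasCompactSupport fun y => f (-y) := hc.comp_homeomorph (Homeomorph.neg ℝ)
  rw [heq]
  refine Continuous.integrable_of_hasCompactSupport ?_ (hc.convolution _ hc')
  exact hc'.continuous_convolution_right _ hf.locallyIntegrable (by fun_prop)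

/-- The phases at t and t - x combine to one that does not depend on t. -/
lemma convolution_modulate (k : ℝ) (f : ℝ → ℝ) (x : ℝ) :
    convolution (modulate k f) (fun y => conj (modulate k f (-y)))
      (ContinuousLinearMap.mul ℂ ℂ) volume x =
      Complex.exp (-(2 * π * k * x : ℝ) * Complex.I) * selfCorrelation f x := by
  rw [selfCorrelation, ← integral_complex_ofReal, ← integral_const_mul, convolution]
  refine integral_congr_ae (Eventually.of_forall fun t => ?_)
  simp only [ContinuousLinearMap.mul_apply', modulate, map_mul, Complex.conj_ofReal,
    ← Complex.exp_conj, neg_sub, Complex.ofReal_mul, map_neg, Complex.conj_I]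
  rw [mul_mul_mul_comm, ← Complex.exp_add]
  congr 2
  push_cast
  ring

/-- The real part of the defining identity of the Fourier transform, for modulated functions. -/
lemma IsFourierTransform.integral_norm_sq_modulate {γ ν : Measure ℝ} [IsLocallyFiniteMeasure γ]
    (h : IsFourierTransform γ ν) (k : ℝ) {f : ℝ → ℝ} (hf : Continuous f)
    (hc : HasCompactSupport f) :
    ∫ y, ‖𝓕⁻ (modulate k f) y‖ ^ 2 ∂ν
      = ∫ x, Real.cos (2 * π * k * x) * selfCorrelation f x ∂γ := by
  have h1 := (h.2 (modulate k f) (continuous_modulate k hf) (hasCompactSupport_modulate k hc)).2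
  simp only [convolution_modulate] at h1
  have hint : Integrable (fun x : ℝ =>
      Complex.exp (-(2 * π * k * x : ℝ) * Complex.I) * selfCorrelation f x) γ := by
    refine (integrable_selfCorrelation hf hc γ).ofReal.bdd_mul (c := 1)
      (Continuous.aestronglyMeasurable (by fun_prop)) (Eventually.of_forall fun x => ?_)
    rw [← Complex.ofReal_neg, Complex.norm_exp_ofReal_mul_I]
  rw [← Complex.ofReal_re (∫ y, ‖𝓕⁻ (modulate k f) y‖ ^ 2 ∂ν), ← h1]
  change RCLike.re (∫ x : ℝ, _ ∂γ : ℂ) = _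
  rw [← integral_re hint]
  refine integral_congr_ae (Eventually.of_forall fun x => ?_)
  change Complex.re _ = _
  rw [Complex.re_mul_ofReal, ← Complex.ofReal_neg, Complex.exp_ofReal_mul_I_re, Real.cos_neg]

/-- The two-step means `translateMean N 1 (translateMean N τ ψ)` have Fourier transforms that
concentrate at the origin. -/
lemma tendsto_integral_norm_sq_fourierInv {γ ν : Measure ℝ} (h : IsFourierTransform γ ν) (k : ℝ)
    {f : ℝ → ℝ} (hf : Continuous f) (hc : HasCompactSupport f) (h1 : ∫ x, f x = 1) :
    Tendsto (fun N => ∫ y, ‖𝓕⁻ (modulate k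
        (translateMean N 1 (translateMean N goldenRatio f))) y‖ ^ 2 ∂ν)
      atTop (𝓝 (ν.real {k})) := by
  have hcont := fun N => continuous_translateMean N goldenRatio hf
  have hsupp := fun N => hasCompactSupport_translateMean N goldenRatio hc
  have hF : ∀ N y, 𝓕⁻ (modulate k (translateMean N 1 (translateMean N goldenRatio f))) y =
      powMean N (Complex.exp ((2 * π * (k - y) * 1 : ℝ) * Complex.I)) *
      (powMean N (Complex.exp ((2 * π * (k - y) * goldenRatio : ℝ) * Complex.I)) *
        𝓕⁻ (modulate k f) y) := fun N y => by
    rw [fourierInv_modulate_translateMean N 1 k (hcont N) (hsupp N),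
      fourierInv_modulate_translateMean N goldenRatio k hf hc]
  have hlim : ν.real {k} = ∫ y, Set.indicator {k} (fun _ => (1 : ℝ)) y ∂ν := by
    rw [integral_indicator_const _ (measurableSet_singleton k)]; simp
  rw [hlim]
  refine tendsto_integral_of_dominated_convergence (fun y => ‖𝓕⁻ (modulate k f) y‖ ^ 2)
    (fun N => ?_) ?_ (fun N => Eventually.of_forall fun y => ?_) (Eventually.of_forall fun y => ?_)
  · exact ((h.2 _ (continuous_modulate k (continuous_translateMean N 1 (hcont N)))
      (hasCompactSupport_modulate k (hasCompactSupport_translateMean N 1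
        (hsupp N)))).1.aestronglyMeasurable.norm.pow 2)
  · exact (memLp_two_iff_integrable_sq_norm
      (h.2 _ (continuous_modulate k hf) (hasCompactSupport_modulate k hc)).1.aestronglyMeasurable).1
      (h.2 _ (continuous_modulate k hf) (hasCompactSupport_modulate k hc)).1
  · rw [Real.norm_of_nonneg (by positivity), hF, norm_mul, norm_mul]
    gcongr
    have b1 := norm_powMean_le N (Complex.norm_exp_ofReal_mul_I (2 * π * (k - y) * 1))
    have b2 := norm_powMean_le N (Complex.norm_exp_ofReal_mul_I (2 * π * (k - y) * goldenRatio))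
    have b3 : _ * ‖𝓕⁻ (modulate k f) y‖ ≤ _ := mul_le_mul_of_nonneg_right b2 (norm_nonneg _)
    rw [one_mul] at b3
    exact (mul_le_of_le_one_left (by positivity) b1).trans b3
  · simp only [hF]
    by_cases hy : y = k
    · subst hy
      refine tendsto_const_nhds.congr' ?_
      filter_upwards [eventually_ne_atTop 0] with N hN
      simp [powMean_one hN, fourierInv_modulate_self, h1]
    · rw [Set.indicator_of_notMem (by simpa using hy)]
      have hb : ∀ (N : ℕ) (t : ℝ), ‖powMean N (Complex.exp (t * Complex.I))‖ ≤ 1 := fun N t =>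
        norm_powMean_le N (Complex.norm_exp_ofReal_mul_I t)
      set w₁ := Complex.exp ((2 * π * (k - y) * 1 : ℝ) * Complex.I) with hw₁
      set w₂ := Complex.exp ((2 * π * (k - y) * goldenRatio : ℝ) * Complex.I) with hw₂
      -- This is why two steps are averaged: k - y and (k - y)τ are both integers only if y = k, as
      -- τ is irrational.
      have hne : w₁ ≠ 1 ∨ w₂ ≠ 1 := by
        by_contra! hcon
        obtain ⟨m, hm⟩ := Complex.exp_eq_one_iff.1 (hw₁ ▸ hcon.1)
        obtain ⟨n, hn⟩ := Complex.exp_eq_one_iff.1 (hw₂ ▸ hcon.2)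
        have hpi : (2 * π * Complex.I : ℂ) ≠ 0 := Complex.two_pi_I_ne_zero
        have hm' : k - y = m := by
          have : ((k - y : ℝ) : ℂ) = (m : ℂ) := by
            apply mul_right_cancel₀ hpi; rw [← hm]; push_cast; ring
          exact_mod_cast this
        have hn' : (k - y) * goldenRatio = n := by
          have : (((k - y) * goldenRatio : ℝ) : ℂ) = (n : ℂ) := by
            apply mul_right_cancel₀ hpi; rw [← hn]; push_cast; ring
          exact_mod_cast this
        have hm0 : m ≠ 0 := by
          rintro rfl
          exact hy (by simpa [sub_eq_zero, eq_comm] using hm')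
        rw [hm'] at hn'
        exact (goldenRatio_irrational.intCast_mul hm0).ne_int n hn'
      have hlim0 : Tendsto (fun N => powMean N w₁ * (powMean N w₂ * 𝓕⁻ (modulate k f) y))
          atTop (𝓝 0) := by
        simp only [← mul_assoc]
        rw [← zero_mul (𝓕⁻ (modulate k f) y)]
        refine Tendsto.mul_const _ ?_
        rcases hne with hne | hne
        · exact (tendsto_powMean (Complex.norm_exp_ofReal_mul_I _) hne).zero_mul_isBoundedUnder_le
            (isBoundedUnder_of ⟨1, fun N => hb N _⟩)
        · exact isBoundedUnder_le_mul_tendsto_zero (isBoundedUnder_of ⟨1, fun N => hb N _⟩)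
            (tendsto_powMean (Complex.norm_exp_ofReal_mul_I _) hne)
      simpa using (hlim0.norm.pow 2)

/-! ### Comparison of intensities and conclusion -/

/-- If the character `e^{2πikx}` is close to `1` on the support of the autocorrelation, then the
intensity at `k` is close to the intensity at `0`. -/
theorem one_sub_mul_braggIntensity_zero_le {Λ : Set ℝ} {A : ℕ → Set ℝ} {ν : Measure ℝ}
    (hν : IsDiffractionMeasure Λ A ν) (hfin : ∀ a, ((Λ - Λ) ∩ Set.Icc (-a) a).Finite)
    {k ε : ℝ} (hk : ∀ z ∈ Λ - Λ, 1 - ε ≤ Real.cos (2 * π * k * z)) :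
    (1 - ε) * braggIntensity ν 0 ≤ braggIntensity ν k := by
  obtain ⟨γ, hγ, hF⟩ := hν
  have := hγ.isLocallyFiniteMeasure hfin
  -- Any nonnegative continuous compactly supported function of integral 1 would do; nonnegativity
  -- keeps the correlations nonnegative.
  let b : ContDiffBump (0 : ℝ) := default
  let f : ℝ → ℝ := b.normed volume
  have hf : Continuous f := b.continuous_normed
  have hc : HasCompactSupport f := b.hasCompactSupport_normed
  have h1 : ∫ x, f x = 1 := b.integral_normed
  refine le_of_tendsto_of_tendsto'
    ((tendsto_integral_norm_sq_fourierInv hF 0 hf hc h1).const_mul (1 - ε))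
    (tendsto_integral_norm_sq_fourierInv hF k hf hc h1) fun N => ?_
  set g := translateMean N 1 (translateMean N goldenRatio f)
  have hg : Continuous g := continuous_translateMean _ _ (continuous_translateMean _ _ hf)
  have hgc : HasCompactSupport g :=
    hasCompactSupport_translateMean _ _ (hasCompactSupport_translateMean _ _ hc)
  have hg0 : ∀ x, 0 ≤ g x :=
    translateMean_nonneg _ _ (translateMean_nonneg _ _ fun x => b.nonneg_normed x)
  have hint := integrable_selfCorrelation hg hgc γ
  rw [hF.integral_norm_sq_modulate 0 hg hgc, hF.integral_norm_sq_modulate k hg hgc,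
    ← integral_const_mul]
  refine integral_mono_ae ?_ ?_ ?_
  · simpa using hint.const_mul (1 - ε)
  · exact hint.bdd_mul (c := 1) (Continuous.aestronglyMeasurable (by fun_prop))
      (Eventually.of_forall fun x => Real.abs_cos_le_one _)
  · filter_upwards [hγ.ae_mem (p := fun z => 1 - ε ≤ Real.cos (2 * π * k * z))
      (measurableSet_le (by fun_prop) (by fun_prop)) hk] with x hx
    simpa using mul_le_mul_of_nonneg_right hx (selfCorrelation_nonneg hg0 x)

/-- Among the dual lattice points with conjugate at most `ε / (2πτ)`, every interval of length
`π τ⁵ / (5 ε)` contains a position of intensity at least `(1 - ε) ν({0})`. -/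
theorem exists_mem_Icc_le_braggIntensity {Λ : Set ℝ} (hΛ : Λ ⊆ Fib) {A : ℕ → Set ℝ}
    {ν : Measure ℝ} (hν : IsDiffractionMeasure Λ A ν) {ε : ℝ} (hε : 0 < ε) (hε1 : ε ≤ 1) (x : ℝ) :
    ∃ k ∈ Set.Icc x (x + π * goldenRatio ^ 5 / (5 * ε)),
      (1 - ε) * braggIntensity ν 0 ≤ braggIntensity ν k := by
  obtain ⟨k, l, hkl, hk, hl⟩ := exists_isGoldenDual_mem_Icc hε hε1 x
  have hsub : Λ - Λ ⊆ Fib - Fib := Set.sub_subset_sub hΛ hΛ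
  exact ⟨k, hk, one_sub_mul_braggIntensity_zero_le hν
    (fun a => (finite_golden_sub_inter_Icc a).subset (Set.inter_subset_inter_left _ hsub))
    fun z hz => hkl.one_sub_le_cos hε hε1 hl (hsub hz)⟩

theorem mainTheorem8 (Λ : Set ℝ) (hΛ : Λ ⊆ Fib)
    (A : ℕ → Set ℝ) (hA : IsVanHove A)
    (ν : Measure ℝ) (hν : IsDiffractionMeasure Λ A ν)
    (I : ℝ) (hI : braggIntensity ν 0 = I) (hIpos : 0 < I) :
    (∀ ε : ℝ, 0 < ε → ε < 1 → ∀ x : ℝ,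
      ∃ k ∈ Set.Icc x (x + 2 * π * goldenRatio ^ 4 / (5 * ε)),
        HasBraggPeak ν k ∧ (1 - ε) * I ≤ braggIntensity ν k) ∧
    (∀ x : ℝ, ∃ k ∈ Set.Icc x (x + 2 * π * goldenRatio ^ 4 / 5), HasBraggPeak ν k) := by
  have hg := goldenRatio_pos
  have hg2 := goldenRatio_lt_two
  subst hI
  refine ⟨fun ε hε hε1 x => ?_, fun x => ?_⟩
  · obtain ⟨k, hk, hle⟩ := exists_mem_Icc_le_braggIntensity hΛ hν hε hε1.le x
    refine ⟨k, ⟨hk.1, hk.2.trans ?_⟩, (mul_pos (by linarith) hIpos).trans_le hle, hle⟩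
    gcongr x + ?_ / _
    calc π * goldenRatio ^ 5 = goldenRatio * (π * goldenRatio ^ 4) := by ring
      _ ≤ 2 * (π * goldenRatio ^ 4) := by gcongr
      _ = 2 * π * goldenRatio ^ 4 := by ring
  -- ε = τ/2 turns πτ⁵/(5ε) into exactly 2πτ⁴/5, and τ < 2 leaves 1 - ε > 0.
  · obtain ⟨k, hk, hle⟩ := exists_mem_Icc_le_braggIntensity hΛ hν
      (ε := goldenRatio / 2) (by positivity) (by linarith) x
    refine ⟨k, ?_, (mul_pos (by linarith) hIpos).trans_le hle⟩
    convert hk using 3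
    field_simp
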